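/- Let $M$ be a smooth ($C^\infty$) finite-dimensional manifold without boundary, and let $g$ be a smooth semi-Riemannian metric on $M$ (symmetric and nondegenerate, of arbitrary signature), with Levi-Civita connection $\nabla$. For $X\in T_pM$ and $u\in T_pM$, let $X^V, X^H\in T_u(TM)$ denote the vertical lift of $X$ and the horizontal lift of $X$ with respect to $\nabla$; in the coordinates $(x^i,y^i)$ of $TM$ induced by coordinates $(x^i)$ of $M$, $$X^V=X^i\frac{\partial}{\partial y^i},\qquad X^H=X^i\frac{\partial}{\partial x^i}-\Gamma^k_{ij}X^iu^j\frac{\partial}{\partial y^k}.$$ Let $\hat g$ be the complete lift of $g$ to the tangent bundle $TM$, that is, the field of bilinear forms on $TM$ determined by $$\hat g(X^H,Y^H)=\hat g(X^V,Y^V)=0,\qquad \hat g(X^H,Y^V)=\hat g(X^V,Y^H)=g(X,Y)$$ for all $X,Y\in T_pM$, at every $u\in T_pM$. Then $\hat g$ is a smooth semi-Riemannian metric on $TM$, and: (i) $(TM,\hat g)$ is flat if and only if $(M,g)$ is flat; (ii) $(TM,\hat g)$ is Ricci flat if and only if $(M,g)$ is Ricci flat; (iii) $(TM,\hat g)$ is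 scalar flat. Here a semi-Riemannian manifold is called flat, Ricci flat or scalar flat if, respectively, the curvature tensor $R(X,Y)Z=\nabla_X\nabla_YZ-\nabla_Y\nabla_XZ-\nabla_{[X,Y]}Z$ of its Levi-Civita connection, its Ricci tensor $\rho(Y,Z)=\operatorname{tr}(X\mapsto R(X,Y)Z)$, or its scalar curvature (the trace of $\rho$ with respect to the metric) vanishes identically. -/

import Mathlib

set_option maxSynthPendingDepth 3

open scoped Manifold ContDiff
open Bundle

/-! ### Levi-Civita connection and curvature of a metric on (an open subset of) a vector space -/

namespace CoordMetric

variable {E : Type*} [NormedAddCommGroup E] [NormedSpace ℝ E]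

/-- The Koszul expression of a field of bilinear forms `G` on `E` at `x`: the trilinear form
`(v, w, z) ↦ (1/2) (∂_v G(w, z) + ∂_w G(v, z) - ∂_z G(v, w))`. -/
noncomputable def koszul (G : E → E →L[ℝ] E →L[ℝ] ℝ) (x : E) :
    E →L[ℝ] E →L[ℝ] E →L[ℝ] ℝ :=
  (1 / 2 : ℝ) • (fderiv ℝ G x + (fderiv ℝ G x).flip -
    (ContinuousLinearMap.flipₗᵢ ℝ E E ℝ).toContinuousLinearEquiv.toContinuousLinearMap ∘L
      (fderiv ℝ G x).flip)

theorem koszul_apply (G : E → E →L[ℝ] E →L[ℝ] ℝ) (x v w z : E) :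
    koszul G x v w z =
      (1 / 2 : ℝ) * (fderiv ℝ G x v w z + fderiv ℝ G x w v z - fderiv ℝ G x z v w) := by
  simp [koszul]

/-- The Christoffel symbols `Γ_x(v, w)` of the Levi-Civita connection of `G`, so that
`(∇_v W)(x) = ∂_v W(x) + Γ_x(v, W x)`. The index of the Koszul expression is raised with `G x`,
seen as a map from `E` to its dual. -/
noncomputable def christoffel (G : E → E →L[ℝ] E →L[ℝ] ℝ) (x : E) : E →L[ℝ] E →L[ℝ] E :=
  ContinuousLinearMap.compL ℝ E (E →L[ℝ] ℝ) E (G x).inverse ∘L koszul G x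

theorem christoffel_apply (G : E → E →L[ℝ] E →L[ℝ] ℝ) (x v w : E) :
    christoffel G x v w = (G x).inverse (koszul G x v w) := rfl

/-- The curvature `R(u, v)w = ∇_u ∇_v w - ∇_v ∇_u w - ∇_[u,v] w` at `x`, in terms of the
Christoffel symbols. -/
noncomputable def riemann (G : E → E →L[ℝ] E →L[ℝ] ℝ) (x u v w : E) : E :=
  fderiv ℝ (christoffel G) x u v w - fderiv ℝ (christoffel G) x v u w
    + christoffel G x u (christoffel G x v w) - christoffel G x v (christoffel G x u w)

/-- The endomorphism `u ↦ R(u, v)w`. -/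
noncomputable def riemannEnd (G : E → E →L[ℝ] E →L[ℝ] ℝ) (x v w : E) : E →ₗ[ℝ] E where
  toFun u := riemann G x u v w
  map_add' a b := by simp only [riemann, map_add, add_apply]; abel
  map_smul' c a := by
    simp only [riemann, map_smul, smul_apply, RingHom.id_apply, smul_sub,
      smul_add]

/-- The Ricci tensor `ρ(v, w) = tr (u ↦ R(u, v)w)`. -/
noncomputable def ricci (G : E → E →L[ℝ] E →L[ℝ] ℝ) (x : E) : E →ₗ[ℝ] E →ₗ[ℝ] ℝ :=
  LinearMap.mk₂ ℝ (fun v w ↦ LinearMap.trace ℝ E (riemannEnd G x v w))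
    (fun a b w ↦ by
      rw [← map_add]; congr 1; ext u
      simp only [riemannEnd, riemann, LinearMap.coe_mk, AddHom.coe_mk, LinearMap.add_apply,
        map_add, add_apply]; abel)
    (fun c a w ↦ by
      rw [← map_smul]; congr 1; ext u
      simp only [riemannEnd, riemann, LinearMap.coe_mk, AddHom.coe_mk, LinearMap.smul_apply,
        map_smul, smul_apply, smul_sub, smul_add])
    (fun v a b ↦ by
      rw [← map_add]; congr 1; ext u
      simp only [riemannEnd, riemann, LinearMap.coe_mk, AddHom.coe_mk, LinearMap.add_apply,
        map_add]; abel)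
    (fun c v a ↦ by
      rw [← map_smul]; congr 1; ext u
      simp only [riemannEnd, riemann, LinearMap.coe_mk, AddHom.coe_mk, LinearMap.smul_apply,
        map_smul, smul_sub, smul_add])

theorem ricci_apply (G : E → E →L[ℝ] E →L[ℝ] ℝ) (x v w : E) :
    ricci G x v w = LinearMap.trace ℝ E (riemannEnd G x v w) := rfl

/-- The scalar curvature: the trace of the Ricci tensor with respect to `G x`, that is, the trace
of the endomorphism obtained by raising one index of the Ricci tensor. -/
noncomputable def scalar [FiniteDimensional ℝ E] (G : E → E →L[ℝ] E →L[ℝ] ℝ) (x : E) : ℝ :=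
  LinearMap.trace ℝ E ((G x).inverse.toLinearMap ∘ₗ
    (LinearMap.toContinuousLinearMap (𝕜 := ℝ) (E := E) (F' := ℝ)).toLinearMap ∘ₗ ricci G x)

end CoordMetric

/-! ### Semi-Riemannian manifolds -/

section Manifold

variable {E : Type*} [NormedAddCommGroup E] [NormedSpace ℝ E]
  {H : Type*} [TopologicalSpace H] (I : ModelWithCorners ℝ E H)
  {M : Type*} [TopologicalSpace M] [ChartedSpace H M]

/-- A field `g` of bilinear forms on the tangent spaces of `M` is a (smooth) semi-Riemannian
metric if it is symmetric and nondegenerate, of any signature, and smooth as a section of the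
bundle of bilinear forms. -/
structure IsSemiRiemannianMetric [IsManifold I ∞ M]
    (g : ∀ p : M, TangentSpace I p →L[ℝ] TangentSpace I p →L[ℝ] ℝ) : Prop where
  symm : ∀ (p : M) (v w : TangentSpace I p), g p v w = g p w v
  nondegenerate : ∀ (p : M) (v : TangentSpace I p), (∀ w, g p v w = 0) → v = 0
  contMDiff : ContMDiff I (I.prod 𝓘(ℝ, E →L[ℝ] E →L[ℝ] ℝ)) ∞
    (fun p ↦ TotalSpace.mk' (E →L[ℝ] E →L[ℝ] ℝ)
      (E := fun q : M ↦ TangentSpace I q →L[ℝ] TangentSpace I q →L[ℝ] ℝ) p (g p))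

/-- The coordinate expression of `g` in the preferred chart `φ` at `p`, i.e. the pullback of `g`
by `φ⁻¹`, as a function on (the image of `φ` in) the model vector space `E`. -/
noncomputable def localMetric
    (g : ∀ p : M, TangentSpace I p →L[ℝ] TangentSpace I p →L[ℝ] ℝ) (p : M) (x : E) :
    E →L[ℝ] E →L[ℝ] ℝ :=
  let B : E →L[ℝ] E →L[ℝ] ℝ := g ((extChartAt I p).symm x)
  let A : E →L[ℝ] E := mfderiv 𝓘(ℝ, E) I (extChartAt I p).symm x
  B.bilinearComp A A

/-! In Mathlib the tangent space `TangentSpace I p` is the model space `E`, a vector being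
identified with its coordinates in the preferred chart at `p`. A tensor at `p` is thus given by its
components at `p` in this chart. -/

/-- The Christoffel symbols at `p` of the Levi-Civita connection of `g`, in the preferred chart
at `p`. -/
noncomputable def christoffelAt
    (g : ∀ p : M, TangentSpace I p →L[ℝ] TangentSpace I p →L[ℝ] ℝ) (p : M) :
    TangentSpace I p →L[ℝ] TangentSpace I p →L[ℝ] TangentSpace I p :=
  (CoordMetric.christoffel (E := E) (localMetric I g p) (extChartAt I p p) : E →L[ℝ] E →L[ℝ] E)

/-- The curvature tensor `R(u, v)w` at `p` of the Levi-Civita connection of `g`. -/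
noncomputable def riemannTensor
    (g : ∀ p : M, TangentSpace I p →L[ℝ] TangentSpace I p →L[ℝ] ℝ) (p : M)
    (u v w : TangentSpace I p) : TangentSpace I p :=
  (CoordMetric.riemann (E := E) (localMetric I g p) (extChartAt I p p) (u : E) (v : E) (w : E) : E)

/-- The Ricci tensor of `g` at `p`. -/
noncomputable def ricciTensor
    (g : ∀ p : M, TangentSpace I p →L[ℝ] TangentSpace I p →L[ℝ] ℝ) (p : M)
    (v w : TangentSpace I p) : ℝ :=
  CoordMetric.ricci (E := E) (localMetric I g p) (extChartAt I p p) v w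

/-- The scalar curvature of `g` at `p`. -/
noncomputable def scalarCurvature [FiniteDimensional ℝ E]
    (g : ∀ p : M, TangentSpace I p →L[ℝ] TangentSpace I p →L[ℝ] ℝ) (p : M) : ℝ :=
  CoordMetric.scalar (localMetric I g p) (extChartAt I p p)

/-- `(M, g)` is flat: the curvature tensor vanishes identically. -/
def IsFlat (g : ∀ p : M, TangentSpace I p →L[ℝ] TangentSpace I p →L[ℝ] ℝ) : Prop :=
  ∀ (p : M) (u v w : TangentSpace I p), riemannTensor I g p u v w = 0

/-- `(M, g)` is Ricci flat: the Ricci tensor vanishes identically. -/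
def IsRicciFlat (g : ∀ p : M, TangentSpace I p →L[ℝ] TangentSpace I p →L[ℝ] ℝ) : Prop :=
  ∀ (p : M) (v w : TangentSpace I p), ricciTensor I g p v w = 0

/-- `(M, g)` is scalar flat: the scalar curvature vanishes identically. -/
def IsScalarFlat [FiniteDimensional ℝ E]
    (g : ∀ p : M, TangentSpace I p →L[ℝ] TangentSpace I p →L[ℝ] ℝ) : Prop :=
  ∀ p : M, scalarCurvature I g p = 0

/-! ### Horizontal and vertical lifts, and the complete lift of the metric

Let `x` be the preferred chart of `M` at `p`. The preferred chart of `TM` at a point `U` of `T_p M`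
is the induced chart `(x, y)`, where `y` are the components of tangent vectors in the chart `x`.
So `T_U (TM)` is `E × E`, the pair `(a, b)` being `a^i ∂/∂x^i + b^i ∂/∂y^i`. -/

variable [IsManifold I ∞ M]

/-- The vertical lift `X^V` to `T_U (TM)` of a vector `X` in `T_p M`, where `U` is in `T_p M`:
`X^V = X^i ∂/∂y^i`. -/
noncomputable def verticalLift (U : TangentBundle I M) :
    TangentSpace I U.proj →L[ℝ] TangentSpace I.tangent U :=
  (ContinuousLinearMap.inr ℝ E E : E →L[ℝ] E × E)

/-- The horizontal lift `X^H` to `T_U (TM)` of a vector `X` in `T_p M` with respect to the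
Levi-Civita connection of `g`, where `U` is in `T_p M`:
`X^H = X^i ∂/∂x^i - Γ^k_{ij} X^i U^j ∂/∂y^k`. -/
noncomputable def horizontalLift
    (g : ∀ p : M, TangentSpace I p →L[ℝ] TangentSpace I p →L[ℝ] ℝ) (U : TangentBundle I M) :
    TangentSpace I U.proj →L[ℝ] TangentSpace I.tangent U :=
  let Γ : E →L[ℝ] E →L[ℝ] E := christoffelAt I g U.proj
  let y : E := U.snd
  ((ContinuousLinearMap.id ℝ E).prod (-(Γ.flip y)) : E →L[ℝ] E × E)

/-- The vector `X` with `ξ = X^H + Y^V` (see `eq_horizontalLift_add_verticalLift`): the image of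
`ξ` under the differential of the projection `TM → M`. -/
noncomputable def horizontalPart (U : TangentBundle I M) :
    TangentSpace I.tangent U →L[ℝ] TangentSpace I U.proj :=
  (ContinuousLinearMap.fst ℝ E E : E × E →L[ℝ] E)

/-- The vector `Y` with `ξ = X^H + Y^V` (see `eq_horizontalLift_add_verticalLift`): the image of
`ξ` under the connection map. -/
noncomputable def verticalPart
    (g : ∀ p : M, TangentSpace I p →L[ℝ] TangentSpace I p →L[ℝ] ℝ) (U : TangentBundle I M) :
    TangentSpace I.tangent U →L[ℝ] TangentSpace I U.proj :=
  let Γ : E →L[ℝ] E →L[ℝ] E := christoffelAt I g U.proj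
  let y : E := U.snd
  (ContinuousLinearMap.snd ℝ E E + Γ.flip y ∘L ContinuousLinearMap.fst ℝ E E : E × E →L[ℝ] E)

/-- The complete lift of `g` to `TM`: for `ξ = X^H + Y^V` and `η = X'^H + Y'^V`,
`ĝ(ξ, η) = g(X, Y') + g(Y, X')`. -/
noncomputable def completeLift
    (g : ∀ p : M, TangentSpace I p →L[ℝ] TangentSpace I p →L[ℝ] ℝ) (U : TangentBundle I M) :
    TangentSpace I.tangent U →L[ℝ] TangentSpace I.tangent U →L[ℝ] ℝ :=
  let B : E →L[ℝ] E →L[ℝ] ℝ := g U.proj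
  let h : E × E →L[ℝ] E := horizontalPart I U
  let k : E × E →L[ℝ] E := verticalPart I g U
  (B.bilinearComp h k + B.bilinearComp k h : E × E →L[ℝ] E × E →L[ℝ] ℝ)

section Lifts

variable (g : ∀ p : M, TangentSpace I p →L[ℝ] TangentSpace I p →L[ℝ] ℝ) (U : TangentBundle I M)

theorem horizontalPart_horizontalLift (X : TangentSpace I U.proj) :
    horizontalPart I U (horizontalLift I g U X) = X := rfl

theorem horizontalPart_verticalLift (X : TangentSpace I U.proj) :
    horizontalPart I U (verticalLift I U X) = 0 := rfl

theorem verticalPart_horizontalLift (X : TangentSpace I U.proj) :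
    verticalPart I g U (horizontalLift I g U X) = 0 :=
  neg_add_cancel (G := E) _

theorem verticalPart_verticalLift (X : TangentSpace I U.proj) :
    verticalPart I g U (verticalLift I U X) = X := by
  have h : ∀ (Γ : E →L[ℝ] E →L[ℝ] E) (a b : E), a + Γ 0 b = a := by simp
  exact h (christoffelAt I g U.proj) X U.snd

theorem eq_horizontalLift_add_verticalLift (ξ : TangentSpace I.tangent U) :
    ξ = horizontalLift I g U (horizontalPart I U ξ) +
      verticalLift I U (verticalPart I g U ξ) := by
  have h : ∀ (a b c : E), ((a, b) : E × E) = (a, -c) + (0, b + c) := by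
    intro a b c; ext <;> simp
  exact h ξ.1 ξ.2 _

theorem completeLift_apply (ξ η : TangentSpace I.tangent U) :
    completeLift I g U ξ η =
      g U.proj (horizontalPart I U ξ) (verticalPart I g U η) +
        g U.proj (verticalPart I g U ξ) (horizontalPart I U η) := rfl

theorem completeLift_horizontal_horizontal (X Y : TangentSpace I U.proj) :
    completeLift I g U (horizontalLift I g U X) (horizontalLift I g U Y) = 0 := by
  rw [completeLift_apply, verticalPart_horizontalLift, verticalPart_horizontalLift]; simp

theorem completeLift_vertical_vertical (X Y : TangentSpace I U.proj) :
    completeLift I g U (verticalLift I U X) (verticalLift I U Y) = 0 := by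
  rw [completeLift_apply, horizontalPart_verticalLift, horizontalPart_verticalLift]; simp

theorem completeLift_horizontal_vertical (X Y : TangentSpace I U.proj) :
    completeLift I g U (horizontalLift I g U X) (verticalLift I U Y) = g U.proj X Y := by
  rw [completeLift_apply, verticalPart_horizontalLift, horizontalPart_verticalLift,
    horizontalPart_horizontalLift, verticalPart_verticalLift]; simp

theorem completeLift_vertical_horizontal (X Y : TangentSpace I U.proj) :
    completeLift I g U (verticalLift I U X) (horizontalLift I g U Y) = g U.proj X Y := by
  rw [completeLift_apply, verticalPart_horizontalLift, horizontalPart_verticalLift,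
    horizontalPart_horizontalLift, verticalPart_verticalLift]; simp

end Lifts

end Manifold

/-! In induced coordinates `(x, y)` on `TM`, the complete lift is the total derivative of the
function `(x, a, a') ↦ g_x(a, a')`: since `∇g = 0` and `Γ` is symmetric, `∂_y g(a, a') = g(Γ(a, y),
a') + g(a, Γ(a', y))`, and these are the terms that the horizontal lifts contribute
(`completeLift_eq_liftBilin`). Total differentiation obeys the Leibniz rule, so it commutes with the
construction of the Levi-Civita connection and of the curvature. The Christoffel symbols of `ĝ` are
`Γ` paired with its total derivative (`christoffel_liftBilin`), and likewise for the curvature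
(`riemann_liftBilin`).

The claims follow by linear algebra. The base component of `R̂` is `R`, and the fibre component is
made of `R` and `dR`, so flatness passes both ways. The map `ζ ↦ R̂(ζ, ξ)η` is block triangular with
two diagonal blocks `R`, so the Ricci tensor of `ĝ` is twice the pullback of `ρ`
(`ricci_liftBilin`). Raising an index of such a tensor gives an endomorphism that kills vertical
vectors and has vertical values, hence has trace zero (`scalar_liftBilin`).

Curvature at a point is defined through the preferred chart there, so the coordinate results must
also be carried between charts. This rests on the naturality of `liftBilin`
(`IsPullbackOn.liftBilin_eq`) and of the curvature (`IsPullbackOn.riemann_eq`). -/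

open scoped Topology

/-! ### Levi-Civita calculus in coordinates -/

namespace CoordMetric

variable {E : Type*} [NormedAddCommGroup E] [NormedSpace ℝ E]
  {F : Type*} [NormedAddCommGroup F] [NormedSpace ℝ F]

theorem fderiv_apply_apply {E₁ E₂ : Type*} [NormedAddCommGroup E₁] [NormedSpace ℝ E₁]
    [NormedAddCommGroup E₂] [NormedSpace ℝ E₂] {T : E → E₁ →L[ℝ] E₂ →L[ℝ] F} {x : E}
    (hT : DifferentiableAt ℝ T x) (u : E) (a : E₁) (b : E₂) :
    fderiv ℝ (fun x ↦ T x a b) x u = fderiv ℝ T x u a b := by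
  have h1 : HasFDerivAt (fun x ↦ T x a b) _ x :=
    (hT.hasFDerivAt.clm_apply (hasFDerivAt_const a x)).clm_apply (hasFDerivAt_const b x)
  rw [h1.fderiv]; simp

theorem fderiv_fderiv_symm {f : E → F} {Ω : Set E} (hΩ : IsOpen Ω) (hf : ContDiffOn ℝ ∞ f Ω)
    {x : E} (hx : x ∈ Ω) (u v : E) :
    fderiv ℝ (fderiv ℝ f) x u v = fderiv ℝ (fderiv ℝ f) x v u := by
  have h : ContDiffAt ℝ ∞ f x := hf.contDiffAt (hΩ.mem_nhds hx)
  exact h.isSymmSndFDerivAt (by simpa using ENat.LEInfty.out) u v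

theorem contDiffOn_fderiv {f : E → F} {Ω : Set E} (hΩ : IsOpen Ω) (hf : ContDiffOn ℝ ∞ f Ω) :
    ContDiffOn ℝ ∞ (fderiv ℝ f) Ω :=
  hf.fderiv_of_isOpen hΩ (by simp)

theorem differentiableAt_of_contDiffOn {f : E → F} {Ω : Set E} (hΩ : IsOpen Ω)
    (hf : ContDiffOn ℝ ∞ f Ω) {x : E} (hx : x ∈ Ω) : DifferentiableAt ℝ f x :=
  (hf.contDiffAt (hΩ.mem_nhds hx)).differentiableAt (by simp)

/-! ### Metrics on an open subset of a finite-dimensional vector space -/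

/-- `G` restricts to a smooth semi-Riemannian metric on the open set `Ω`. -/
structure IsMetricOn (G : E → E →L[ℝ] E →L[ℝ] ℝ) (Ω : Set E) : Prop where
  isOpen : IsOpen Ω
  contDiffOn : ContDiffOn ℝ ∞ G Ω
  symm : ∀ x ∈ Ω, ∀ v w, G x v w = G x w v
  nondegenerate : ∀ x ∈ Ω, ∀ v, (∀ w, G x v w = 0) → v = 0

namespace IsMetricOn

variable {G : E → E →L[ℝ] E →L[ℝ] ℝ} {Ω : Set E} {x : E}

theorem differentiableAt (hG : IsMetricOn G Ω) (hx : x ∈ Ω) : DifferentiableAt ℝ G x :=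
  differentiableAt_of_contDiffOn hG.isOpen hG.contDiffOn hx

theorem eq_of_forall (hG : IsMetricOn G Ω) (hx : x ∈ Ω) {v w : E}
    (h : ∀ z, G x v z = G x w z) : v = w := by
  refine sub_eq_zero.1 (hG.nondegenerate x hx _ fun z ↦ ?_)
  simp [h z]

theorem fderiv_symm (hG : IsMetricOn G Ω) (hx : x ∈ Ω) (u v w : E) :
    fderiv ℝ G x u v w = fderiv ℝ G x u w v := by
  rw [← fderiv_apply_apply (hG.differentiableAt hx), ← fderiv_apply_apply (hG.differentiableAt hx)]
  have : (fun y ↦ G y v w) =ᶠ[𝓝 x] fun y ↦ G y w v := by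
    filter_upwards [hG.isOpen.mem_nhds hx] with y hy using hG.symm y hy v w
  rw [this.fderiv_eq]

variable [FiniteDimensional ℝ E]

theorem isInvertible (hG : IsMetricOn G Ω) (hx : x ∈ Ω) : (G x).IsInvertible := by
  have hinj : Function.Injective (G x).toLinearMap := by
    refine (injective_iff_map_eq_zero _).2 fun v hv ↦ hG.nondegenerate x hx v fun w ↦ ?_
    have : G x v = 0 := hv
    simp [this]
  have hrk : Module.finrank ℝ E = Module.finrank ℝ (E →L[ℝ] ℝ) := by
    rw [← (LinearMap.toContinuousLinearMap (𝕜 := ℝ) (E := E) (F' := ℝ)).finrank_eq]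
    exact Subspace.dual_finrank_eq.symm
  let e := LinearEquiv.ofInjectiveOfFinrankEq (G x).toLinearMap hinj hrk
  refine ⟨e.toContinuousLinearEquiv, ?_⟩
  ext v w
  rfl

theorem christoffel_spec (hG : IsMetricOn G Ω) (hx : x ∈ Ω) (v w z : E) :
    G x (christoffel G x v w) z = koszul G x v w z := by
  obtain ⟨e, he⟩ := hG.isInvertible hx
  rw [christoffel_apply, ← he, ContinuousLinearMap.inverse_equiv]
  simp

theorem christoffel_eq (hG : IsMetricOn G Ω) (hx : x ∈ Ω) {v w c : E}
    (h : ∀ z, G x c z = koszul G x v w z) : christoffel G x v w = c :=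
  hG.eq_of_forall hx fun z ↦ by rw [hG.christoffel_spec hx, h]

theorem christoffel_symm (hG : IsMetricOn G Ω) (hx : x ∈ Ω) (v w : E) :
    christoffel G x v w = christoffel G x w v := by
  refine hG.christoffel_eq hx fun z ↦ ?_
  rw [hG.christoffel_spec hx, koszul_apply, koszul_apply, hG.fderiv_symm hx z v w]
  ring

theorem compatible (hG : IsMetricOn G Ω) (hx : x ∈ Ω) (u v w : E) :
    fderiv ℝ G x u v w = G x (christoffel G x u v) w + G x v (christoffel G x u w) := by
  rw [hG.symm x hx v, hG.christoffel_spec hx, hG.christoffel_spec hx, koszul_apply, koszul_apply,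
    hG.fderiv_symm hx w u v, hG.fderiv_symm hx v u w, hG.fderiv_symm hx u v w]
  ring

theorem contDiffOn_koszul (hG : IsMetricOn G Ω) : ContDiffOn ℝ ∞ (koszul G) Ω := by
  have h := contDiffOn_fderiv hG.isOpen hG.contDiffOn
  refine contDiffOn_clm_apply.2 fun v ↦ contDiffOn_clm_apply.2 fun w ↦
    contDiffOn_clm_apply.2 fun z ↦ ?_
  simp only [koszul_apply]
  have h' (a b c : E) : ContDiffOn ℝ ∞ (fun y ↦ fderiv ℝ G y a b c) Ω :=
    ((h.clm_apply contDiffOn_const).clm_apply contDiffOn_const).clm_apply contDiffOn_const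
  exact contDiffOn_const.mul (((h' _ _ _).add (h' _ _ _)).sub (h' _ _ _))

theorem contDiffOn_christoffel (hG : IsMetricOn G Ω) : ContDiffOn ℝ ∞ (christoffel G) Ω := by
  refine contDiffOn_clm_apply.2 fun v ↦ contDiffOn_clm_apply.2 fun w ↦ ?_
  simp only [christoffel_apply]
  refine ContDiffOn.clm_apply (fun x hx ↦ ?_)
    ((hG.contDiffOn_koszul.clm_apply contDiffOn_const).clm_apply contDiffOn_const)
  have := FiniteDimensional.complete ℝ E
  exact (((hG.isInvertible hx).contDiffAt_map_inverse).comp x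
    (hG.contDiffOn.contDiffAt (hG.isOpen.mem_nhds hx))).contDiffWithinAt

theorem differentiableAt_christoffel (hG : IsMetricOn G Ω) (hx : x ∈ Ω) :
    DifferentiableAt ℝ (christoffel G) x :=
  differentiableAt_of_contDiffOn hG.isOpen hG.contDiffOn_christoffel hx

/-- Leibniz rule applied to the defining identity of `Γ` in `christoffel_spec`. It is what
identifies the fibre component of the lifted Christoffel symbols. -/
theorem fderiv_christoffel_spec (hG : IsMetricOn G Ω) (hx : x ∈ Ω) (u v w z : E) :
    fderiv ℝ (koszul G) x u v w z = fderiv ℝ G x u (christoffel G x v w) z +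
      G x (fderiv ℝ (christoffel G) x u v w) z := by
  have hK := differentiableAt_of_contDiffOn hG.isOpen hG.contDiffOn_koszul hx
  have h1 : (fun y ↦ koszul G y v w z) =ᶠ[𝓝 x] fun y ↦ G y (christoffel G y v w) z := by
    filter_upwards [hG.isOpen.mem_nhds hx] with y hy using (hG.christoffel_spec hy v w z).symm
  have h2 : HasFDerivAt (fun y ↦ koszul G y v w z) _ x :=
    ((hK.hasFDerivAt.clm_apply (hasFDerivAt_const v x)).clm_apply
      (hasFDerivAt_const w x)).clm_apply (hasFDerivAt_const z x)
  have hΓ := (((hG.differentiableAt_christoffel hx).hasFDerivAt.clm_apply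
    (hasFDerivAt_const v x)).clm_apply (hasFDerivAt_const w x))
  have h3 : HasFDerivAt (fun y ↦ G y (christoffel G y v w) z) _ x :=
    ((hG.differentiableAt hx).hasFDerivAt.clm_apply hΓ).clm_apply (hasFDerivAt_const z x)
  have := congrArg (fun f : E →L[ℝ] ℝ ↦ f u) h1.fderiv_eq
  simp only [h2.fderiv, h3.fderiv] at this
  simpa [add_comm] using this

theorem fderiv_koszul (hG : IsMetricOn G Ω) (hx : x ∈ Ω) (u v w z : E) :
    fderiv ℝ (koszul G) x u v w z = (1 / 2 : ℝ) * (fderiv ℝ (fderiv ℝ G) x u v w z +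
      fderiv ℝ (fderiv ℝ G) x u w v z - fderiv ℝ (fderiv ℝ G) x u z v w) := by
  have hK := differentiableAt_of_contDiffOn hG.isOpen hG.contDiffOn_koszul hx
  have hD := differentiableAt_of_contDiffOn hG.isOpen (contDiffOn_fderiv hG.isOpen hG.contDiffOn) hx
  have h2 : HasFDerivAt (fun y ↦ koszul G y v w z) _ x :=
    ((hK.hasFDerivAt.clm_apply (hasFDerivAt_const v x)).clm_apply
      (hasFDerivAt_const w x)).clm_apply (hasFDerivAt_const z x)
  have h' (a b c : E) : HasFDerivAt (fun y ↦ fderiv ℝ G y a b c) _ x :=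
    ((hD.hasFDerivAt.clm_apply (hasFDerivAt_const a x)).clm_apply
      (hasFDerivAt_const b x)).clm_apply (hasFDerivAt_const c x)
  have h3 : HasFDerivAt (fun y ↦ (1 / 2 : ℝ) * (fderiv ℝ G y v w z + fderiv ℝ G y w v z -
      fderiv ℝ G y z v w)) _ x :=
    (((h' v w z).add (h' w v z)).sub (h' z v w)).const_mul (1 / 2 : ℝ)
  have := congrArg (fun f : E →L[ℝ] ℝ ↦ f u) (h2.unique (h3.congr_of_eventuallyEq
    (Filter.Eventually.of_forall fun y ↦ koszul_apply G y v w z)))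
  simpa using this

end IsMetricOn

/-! ### Complete lifts -/

/-- The complete lift of a field of bilinear maps `T`: the derivative of
`(x, a, b) ↦ T x a b` at `(z.1, ξ.1, η.1)` in the direction `(z.2, ξ.2, η.2)`. -/
noncomputable def liftBilin (T : E → E →L[ℝ] E →L[ℝ] F) (z : E × E) :
    E × E →L[ℝ] E × E →L[ℝ] F :=
  (fderiv ℝ T z.1 z.2).bilinearComp (.fst ℝ E E) (.fst ℝ E E) +
    (T z.1).bilinearComp (.fst ℝ E E) (.snd ℝ E E) +
    (T z.1).bilinearComp (.snd ℝ E E) (.fst ℝ E E)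

theorem liftBilin_apply (T : E → E →L[ℝ] E →L[ℝ] F) (z ξ η : E × E) :
    liftBilin T z ξ η = fderiv ℝ T z.1 z.2 ξ.1 η.1 + T z.1 ξ.1 η.2 + T z.1 ξ.2 η.1 := rfl

theorem contDiffOn_liftBilin [FiniteDimensional ℝ E] {T : E → E →L[ℝ] E →L[ℝ] F} {Ω : Set E}
    (hΩ : IsOpen Ω) (hT : ContDiffOn ℝ ∞ T Ω) :
    ContDiffOn ℝ ∞ (liftBilin T) (Ω ×ˢ Set.univ) := by
  refine contDiffOn_clm_apply.2 fun v ↦ contDiffOn_clm_apply.2 fun w ↦ ?_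
  simp only [liftBilin_apply]
  have hm : Set.MapsTo Prod.fst (Ω ×ˢ (Set.univ : Set E)) Ω := fun z hz ↦ hz.1
  have h1 : ContDiffOn ℝ ∞ (fun z : E × E ↦ T z.1) (Ω ×ˢ Set.univ) :=
    hT.comp contDiffOn_fst hm
  have h2 : ContDiffOn ℝ ∞ (fun z : E × E ↦ fderiv ℝ T z.1) (Ω ×ˢ Set.univ) :=
    (contDiffOn_fderiv hΩ hT).comp contDiffOn_fst hm
  exact ((((h2.clm_apply contDiffOn_snd).clm_apply contDiffOn_const).clm_apply
    contDiffOn_const).add ((h1.clm_apply contDiffOn_const).clm_apply contDiffOn_const)).add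
    ((h1.clm_apply contDiffOn_const).clm_apply contDiffOn_const)

theorem fderiv_liftBilin [FiniteDimensional ℝ E] {T : E → E →L[ℝ] E →L[ℝ] F} {Ω : Set E}
    (hΩ : IsOpen Ω) (hT : ContDiffOn ℝ ∞ T Ω) {z : E × E} (hz : z.1 ∈ Ω) (ζ ξ η : E × E) :
    fderiv ℝ (fun z ↦ liftBilin T z ξ η) z ζ =
      fderiv ℝ (fderiv ℝ T) z.1 ζ.1 z.2 ξ.1 η.1 + fderiv ℝ T z.1 ζ.2 ξ.1 η.1 +
        fderiv ℝ T z.1 ζ.1 ξ.1 η.2 + fderiv ℝ T z.1 ζ.1 ξ.2 η.1 := by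
  have h1 : HasFDerivAt (fun z : E × E ↦ T z.1) _ z :=
    (differentiableAt_of_contDiffOn hΩ hT hz).hasFDerivAt.comp z hasFDerivAt_fst
  have h2 : HasFDerivAt (fun z : E × E ↦ fderiv ℝ T z.1) _ z :=
    (differentiableAt_of_contDiffOn hΩ (contDiffOn_fderiv hΩ hT) hz).hasFDerivAt.comp z
      hasFDerivAt_fst
  have h3 (a b : E) : HasFDerivAt (fun z : E × E ↦ T z.1 a b) _ z :=
    (h1.clm_apply (hasFDerivAt_const a z)).clm_apply (hasFDerivAt_const b z)
  have h4 : HasFDerivAt (fun z : E × E ↦ fderiv ℝ T z.1 z.2 ξ.1 η.1) _ z :=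
    ((h2.clm_apply hasFDerivAt_snd).clm_apply (hasFDerivAt_const ξ.1 z)).clm_apply
      (hasFDerivAt_const η.1 z)
  have h5 : HasFDerivAt (fun z ↦ liftBilin T z ξ η) _ z :=
    (h4.add (h3 ξ.1 η.2)).add (h3 ξ.2 η.1)
  rw [h5.fderiv]
  simp; abel

end CoordMetric

/-! ### Connection and curvature of the lifted metric -/

namespace CoordMetric

variable {E : Type*} [NormedAddCommGroup E] [NormedSpace ℝ E]

theorem riemannEnd_apply (G : E → E →L[ℝ] E →L[ℝ] ℝ) (x u v w : E) :
    riemannEnd G x v w u = riemann G x u v w := rfl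

/-- By cyclicity of the trace, `fst` meets `inr` and the composite vanishes. This discards the block
from base to fibre in both trace computations. -/
theorem trace_inr_comp_comp_fst [FiniteDimensional ℝ E] (T : E →ₗ[ℝ] E) :
    LinearMap.trace ℝ (E × E) (LinearMap.inr ℝ E E ∘ₗ T ∘ₗ LinearMap.fst ℝ E E) = 0 := by
  rw [LinearMap.trace_comp_comm']
  have : (T ∘ₗ LinearMap.fst ℝ E E) ∘ₗ LinearMap.inr ℝ E E = 0 := by ext; simp
  simp [this]

namespace IsMetricOn

variable {G : E → E →L[ℝ] E →L[ℝ] ℝ} {Ω : Set E}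
  [FiniteDimensional ℝ E]

theorem liftBilin (hG : IsMetricOn G Ω) : IsMetricOn (liftBilin G) (Ω ×ˢ Set.univ) where
  isOpen := hG.isOpen.prod isOpen_univ
  contDiffOn := contDiffOn_liftBilin hG.isOpen hG.contDiffOn
  symm z hz ξ η := by
    simp only [liftBilin_apply]
    rw [hG.fderiv_symm hz.1 z.2 ξ.1, hG.symm _ hz.1 ξ.1, hG.symm _ hz.1 ξ.2]
    ring
  nondegenerate z hz ξ h := by
    -- Vertical test vectors see only the base component of `ξ`; once that is zero, vectors `(w, 0)`
    -- detect the fibre component.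
    have h1 : ξ.1 = 0 := hG.nondegenerate _ hz.1 _ fun w ↦ by
      simpa [liftBilin_apply] using h (0, w)
    have h2 : ξ.2 = 0 := hG.nondegenerate _ hz.1 _ fun w ↦ by
      simpa [liftBilin_apply, h1] using h (w, 0)
    exact Prod.ext h1 h2

/-- The Koszul expression is linear in the first derivatives of the metric, so it commutes with
total differentiation as soon as the second derivatives of `G` are symmetric. -/
theorem koszul_liftBilin (hG : IsMetricOn G Ω) {z : E × E} (hz : z.1 ∈ Ω) (ξ η ζ : E × E) :
    koszul (CoordMetric.liftBilin G) z ξ η ζ =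
      fderiv ℝ (koszul G) z.1 z.2 ξ.1 η.1 ζ.1 + koszul G z.1 ξ.2 η.1 ζ.1 +
        koszul G z.1 ξ.1 η.2 ζ.1 + koszul G z.1 ξ.1 η.1 ζ.2 := by
  have hd : DifferentiableAt ℝ (CoordMetric.liftBilin G) z :=
    hG.liftBilin.differentiableAt ⟨hz, Set.mem_univ _⟩
  rw [koszul_apply]
  simp only [← fderiv_apply_apply hd, fderiv_liftBilin hG.isOpen hG.contDiffOn hz]
  rw [hG.fderiv_koszul hz]
  simp only [koszul_apply]
  rw [fderiv_fderiv_symm hG.isOpen hG.contDiffOn hz z.2 ξ.1,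
    fderiv_fderiv_symm hG.isOpen hG.contDiffOn hz z.2 η.1,
    fderiv_fderiv_symm hG.isOpen hG.contDiffOn hz z.2 ζ.1]
  ring

/-- The total derivative of `G(Γ(v, w), z) = koszul G v w z` is the equation characterizing the
lifted Christoffel symbols, and nondegeneracy makes its solution unique. -/
theorem christoffel_liftBilin (hG : IsMetricOn G Ω) {z : E × E} (hz : z.1 ∈ Ω) (ξ η : E × E) :
    christoffel (CoordMetric.liftBilin G) z ξ η =
      (christoffel G z.1 ξ.1 η.1, CoordMetric.liftBilin (christoffel G) z ξ η) := by
  refine hG.liftBilin.christoffel_eq ⟨hz, Set.mem_univ _⟩ fun ζ ↦ ?_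
  rw [hG.koszul_liftBilin hz, hG.fderiv_christoffel_spec hz, liftBilin_apply, liftBilin_apply]
  simp only [map_add, add_apply, hG.christoffel_spec hz]
  ring

theorem fderiv_christoffel_liftBilin (hG : IsMetricOn G Ω) {z : E × E} (hz : z.1 ∈ Ω)
    (ζ ξ η : E × E) :
    fderiv ℝ (christoffel (CoordMetric.liftBilin G)) z ζ ξ η =
      (fderiv ℝ (christoffel G) z.1 ζ.1 ξ.1 η.1,
        fderiv ℝ (fderiv ℝ (christoffel G)) z.1 ζ.1 z.2 ξ.1 η.1 +
          fderiv ℝ (christoffel G) z.1 ζ.2 ξ.1 η.1 +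
          fderiv ℝ (christoffel G) z.1 ζ.1 ξ.1 η.2 +
          fderiv ℝ (christoffel G) z.1 ζ.1 ξ.2 η.1) := by
  have hz' : z ∈ Ω ×ˢ (Set.univ : Set E) := ⟨hz, Set.mem_univ _⟩
  rw [← fderiv_apply_apply (hG.liftBilin.differentiableAt_christoffel hz')]
  have h1 : (fun z ↦ christoffel (CoordMetric.liftBilin G) z ξ η) =ᶠ[𝓝 z]
      fun z ↦ (christoffel G z.1 ξ.1 η.1, CoordMetric.liftBilin (christoffel G) z ξ η) := by
    filter_upwards [hG.liftBilin.isOpen.mem_nhds hz'] with y hy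
      using hG.christoffel_liftBilin hy.1 ξ η
  have h2 : HasFDerivAt (fun z : E × E ↦ christoffel G z.1 ξ.1 η.1) _ z :=
    (((hG.differentiableAt_christoffel hz).hasFDerivAt.comp z hasFDerivAt_fst).clm_apply
      (hasFDerivAt_const ξ.1 z)).clm_apply (hasFDerivAt_const η.1 z)
  have h3 : DifferentiableAt ℝ (fun z ↦ CoordMetric.liftBilin (christoffel G) z ξ η) z :=
    ((differentiableAt_of_contDiffOn hG.liftBilin.isOpen
      (contDiffOn_liftBilin hG.isOpen hG.contDiffOn_christoffel) hz').clm_apply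
      (differentiableAt_const ξ)).clm_apply (differentiableAt_const η)
  rw [h1.fderiv_eq, h2.differentiableAt.fderiv_prodMk h3, h2.fderiv]
  simp [fderiv_liftBilin hG.isOpen hG.contDiffOn_christoffel hz]

theorem fderiv_riemann (hG : IsMetricOn G Ω) {x : E} (hx : x ∈ Ω) (u v w y : E) :
    fderiv ℝ (fun x ↦ riemann G x u v w) x y =
      fderiv ℝ (fderiv ℝ (christoffel G)) x y u v w -
        fderiv ℝ (fderiv ℝ (christoffel G)) x y v u w +
        (fderiv ℝ (christoffel G) x y u (christoffel G x v w) +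
          christoffel G x u (fderiv ℝ (christoffel G) x y v w)) -
        (fderiv ℝ (christoffel G) x y v (christoffel G x u w) +
          christoffel G x v (fderiv ℝ (christoffel G) x y u w)) := by
  have hΓ := (hG.differentiableAt_christoffel hx).hasFDerivAt
  have hD := (differentiableAt_of_contDiffOn hG.isOpen
    (contDiffOn_fderiv hG.isOpen hG.contDiffOn_christoffel) hx).hasFDerivAt
  have h1 (a b c : E) : HasFDerivAt (fun y ↦ fderiv ℝ (christoffel G) y a b c) _ x :=
    ((hD.clm_apply (hasFDerivAt_const a x)).clm_apply
      (hasFDerivAt_const b x)).clm_apply (hasFDerivAt_const c x)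
  have h2 (a b c : E) : HasFDerivAt (fun y ↦ christoffel G y a (christoffel G y b c)) _ x :=
    (hΓ.clm_apply (hasFDerivAt_const a x)).clm_apply
      ((hΓ.clm_apply (hasFDerivAt_const b x)).clm_apply (hasFDerivAt_const c x))
  have h3 : HasFDerivAt (fun x ↦ riemann G x u v w) _ x :=
    (((h1 u v w).sub (h1 v u w)).add (h2 u v w)).sub (h2 v u w)
  rw [h3.fderiv]
  simp only [add_apply, sub_apply,
    ContinuousLinearMap.comp_apply, ContinuousLinearMap.flip_apply, zero_apply, map_zero, zero_add]
  abel

/-- The fibre component is the total derivative of `(x, u, v, w) ↦ R_x(u, v)w`. Beyond the Leibniz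
rule this uses only the symmetry of the second derivatives of `Γ`. -/
theorem riemann_liftBilin (hG : IsMetricOn G Ω) {z : E × E} (hz : z.1 ∈ Ω) (ζ ξ η : E × E) :
    riemann (CoordMetric.liftBilin G) z ζ ξ η =
      (riemann G z.1 ζ.1 ξ.1 η.1,
        fderiv ℝ (fun x ↦ riemann G x ζ.1 ξ.1 η.1) z.1 z.2 + riemann G z.1 ζ.2 ξ.1 η.1 +
          riemann G z.1 ζ.1 ξ.2 η.1 + riemann G z.1 ζ.1 ξ.1 η.2) := by
  have hs := fderiv_fderiv_symm hG.isOpen hG.contDiffOn_christoffel hz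
  ext
  · simp only [riemann, hG.fderiv_christoffel_liftBilin hz, hG.christoffel_liftBilin hz,
      Prod.fst_add, Prod.fst_sub]
  · rw [hG.fderiv_riemann hz]
    simp only [riemann, hG.fderiv_christoffel_liftBilin hz, hG.christoffel_liftBilin hz,
      Prod.snd_add, Prod.snd_sub, liftBilin_apply, map_add, hs z.2]
    abel

theorem ricci_liftBilin (hG : IsMetricOn G Ω) {z : E × E} (hz : z.1 ∈ Ω) (ξ η : E × E) :
    ricci (CoordMetric.liftBilin G) z ξ η = 2 * ricci G z.1 ξ.1 η.1 := by
  rw [ricci_apply, ricci_apply]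
  set R := riemannEnd G z.1 ξ.1 η.1 with hR
  set S := riemannEnd (CoordMetric.liftBilin G) z ξ η with hS
  -- Block triangular form: a vertical `ζ` is sent to a vertical vector by `R` itself, so everything
  -- off the diagonal is read from `S` on vectors `(a, 0)`.
  have h : S = R.prodMap R +
      LinearMap.inr ℝ E E ∘ₗ (LinearMap.snd ℝ E E ∘ₗ S ∘ₗ LinearMap.inl ℝ E E) ∘ₗ
        LinearMap.fst ℝ E E := by
    have h1 (v w y : E) : fderiv ℝ (fun x ↦ riemann G x 0 v w) z.1 y = 0 := by
      have : (fun x ↦ riemann G x 0 v w) = fun _ ↦ 0 := by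
        ext x; exact map_zero (riemannEnd G x v w)
      simp [this]
    have h0 (x v w : E) : riemann G x 0 v w = 0 := map_zero (riemannEnd G x v w)
    apply LinearMap.ext
    intro ζ
    obtain ⟨a, b⟩ := ζ
    simp only [hS, hR, LinearMap.add_apply, LinearMap.prodMap_apply, LinearMap.comp_apply,
      riemannEnd_apply, hG.riemann_liftBilin hz, LinearMap.fst_apply, LinearMap.inl_apply,
      LinearMap.snd_apply, LinearMap.inr_apply, h0]
    ext <;> simp
    abel
  rw [h, map_add, trace_inr_comp_comp_fst, LinearMap.trace_prodMap']
  ring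

theorem scalar_liftBilin (hG : IsMetricOn G Ω) {z : E × E} (hz : z.1 ∈ Ω) :
    scalar (CoordMetric.liftBilin G) z = 0 := by
  unfold scalar
  set S := (CoordMetric.liftBilin G z).inverse.toLinearMap ∘ₗ
    (LinearMap.toContinuousLinearMap (𝕜 := ℝ) (E := E × E) (F' := ℝ)).toLinearMap ∘ₗ
      ricci (CoordMetric.liftBilin G) z with hS
  have key (ξ η : E × E) : CoordMetric.liftBilin G z (S ξ) η = 2 * ricci G z.1 ξ.1 η.1 := by
    obtain ⟨e, he⟩ := hG.liftBilin.isInvertible (x := z) ⟨hz, Set.mem_univ _⟩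
    rw [← hG.ricci_liftBilin hz, hS, ← he, ContinuousLinearMap.inverse_equiv]
    simp
  -- The raised Ricci tensor takes vertical values because the Ricci form vanishes on vertical `η`,
  -- and it kills vertical vectors because the form vanishes on vertical `ξ`.
  have h1 (ξ : E × E) : (S ξ).1 = 0 := hG.nondegenerate _ hz _ fun w ↦ by
    simpa [liftBilin_apply] using key ξ (0, w)
  have h2 (b : E) : S (0, b) = 0 :=
    hG.liftBilin.nondegenerate z ⟨hz, Set.mem_univ _⟩ _ fun w ↦ by simpa using key (0, b) w
  have h : S = LinearMap.inr ℝ E E ∘ₗ (LinearMap.snd ℝ E E ∘ₗ S ∘ₗ LinearMap.inl ℝ E E) ∘ₗ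
      LinearMap.fst ℝ E E := by
    apply LinearMap.ext
    intro ξ
    have : S ξ = S (ξ.1, 0) := by
      conv_lhs => rw [show ξ = (ξ.1, 0) + (0, ξ.2) by simp, map_add, h2, add_zero]
    ext
    · simp [h1]
    · simp [this]
  rw [h, trace_inr_comp_comp_fst]

end IsMetricOn

end CoordMetric

/-! ### Naturality under pullback -/

namespace CoordMetric

variable {E : Type*} [NormedAddCommGroup E] [NormedSpace ℝ E]

/-- `G'` is the pullback of `G` by `φ` on the open set `Ω'`. -/
structure IsPullbackOn (G' G : E → E →L[ℝ] E →L[ℝ] ℝ) (φ : E → E) (Ω' : Set E) : Prop where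
  isOpen : IsOpen Ω'
  contDiffOn : ContDiffOn ℝ ∞ φ Ω'
  eq : ∀ x ∈ Ω', ∀ v w, G' x v w = G (φ x) (fderiv ℝ φ x v) (fderiv ℝ φ x w)

/-- The tangent map of `φ`. -/
noncomputable def tangentLift (φ : E → E) (z : E × E) : E × E := (φ z.1, fderiv ℝ φ z.1 z.2)

theorem fderiv_tangentLift {φ : E → E} {Ω : Set E} (hΩ : IsOpen Ω)
    (hφ : ContDiffOn ℝ ∞ φ Ω) {z : E × E} (hz : z.1 ∈ Ω) (ξ : E × E) :
    fderiv ℝ (tangentLift φ) z ξ =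
      (fderiv ℝ φ z.1 ξ.1, fderiv ℝ (fderiv ℝ φ) z.1 ξ.1 z.2 + fderiv ℝ φ z.1 ξ.2) := by
  have h1 : HasFDerivAt (fun z : E × E ↦ φ z.1) _ z :=
    (differentiableAt_of_contDiffOn hΩ hφ hz).hasFDerivAt.comp z hasFDerivAt_fst
  have h2 : HasFDerivAt (fun z : E × E ↦ fderiv ℝ φ z.1) _ z :=
    (differentiableAt_of_contDiffOn hΩ (contDiffOn_fderiv hΩ hφ) hz).hasFDerivAt.comp z
      hasFDerivAt_fst
  have h3 : HasFDerivAt (tangentLift φ) _ z := h1.prodMk (h2.clm_apply hasFDerivAt_snd)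
  rw [h3.fderiv]
  simp [add_comm]

namespace IsPullbackOn

variable {G' G : E → E →L[ℝ] E →L[ℝ] ℝ} {φ : E → E} {Ω' Ω : Set E} {x : E}

theorem fderiv_eq (h : IsPullbackOn G' G φ Ω') (hx : x ∈ Ω') (hG' : DifferentiableAt ℝ G' x)
    (hG : DifferentiableAt ℝ G (φ x)) (u v w : E) :
    fderiv ℝ G' x u v w =
      fderiv ℝ G (φ x) (fderiv ℝ φ x u) (fderiv ℝ φ x v) (fderiv ℝ φ x w) +
        G (φ x) (fderiv ℝ (fderiv ℝ φ) x u v) (fderiv ℝ φ x w) +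
        G (φ x) (fderiv ℝ φ x v) (fderiv ℝ (fderiv ℝ φ) x u w) := by
  have hφ := (differentiableAt_of_contDiffOn h.isOpen h.contDiffOn hx).hasFDerivAt
  have hD := (differentiableAt_of_contDiffOn h.isOpen
    (contDiffOn_fderiv h.isOpen h.contDiffOn) hx).hasFDerivAt
  have h1 : (fun y ↦ G' y v w) =ᶠ[𝓝 x]
      fun y ↦ G (φ y) (fderiv ℝ φ y v) (fderiv ℝ φ y w) := by
    filter_upwards [h.isOpen.mem_nhds hx] with y hy using h.eq y hy v w
  have h2 : HasFDerivAt (fun y ↦ G (φ y) (fderiv ℝ φ y v) (fderiv ℝ φ y w)) _ x :=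
    ((hG.hasFDerivAt.comp x hφ).clm_apply (hD.clm_apply (hasFDerivAt_const v x))).clm_apply
      (hD.clm_apply (hasFDerivAt_const w x))
  rw [← fderiv_apply_apply hG', h1.fderiv_eq, h2.fderiv]
  simp
  ring

/-- Total differentiation of `G' = φ^* G`: the second derivatives of `φ` that appear are those in
the differential of the tangent map. -/
theorem liftBilin_eq (h : IsPullbackOn G' G φ Ω') {z : E × E} (hz : z.1 ∈ Ω')
    (hG' : DifferentiableAt ℝ G' z.1) (hG : DifferentiableAt ℝ G (φ z.1)) (ξ η : E × E) :
    liftBilin G' z ξ η = liftBilin G (tangentLift φ z) (fderiv ℝ (tangentLift φ) z ξ)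
      (fderiv ℝ (tangentLift φ) z η) := by
  have hs := fderiv_fderiv_symm h.isOpen h.contDiffOn hz
  simp only [liftBilin_apply, fderiv_tangentLift h.isOpen h.contDiffOn hz, tangentLift,
    h.eq _ hz, h.fderiv_eq hz hG' hG, map_add, add_apply, hs z.2]
  ring

/-- Each of the three derivatives of `G'` produces two terms in the second derivative of `φ`; by
symmetry four cancel and two coincide, leaving one inhomogeneous term. -/
theorem koszul_eq (h : IsPullbackOn G' G φ Ω') (hG' : IsMetricOn G' Ω') (hG : IsMetricOn G Ω)
    (hx : x ∈ Ω') (hφx : φ x ∈ Ω) (u v w : E) :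
    koszul G' x u v w = koszul G (φ x) (fderiv ℝ φ x u) (fderiv ℝ φ x v) (fderiv ℝ φ x w) +
      G (φ x) (fderiv ℝ (fderiv ℝ φ) x u v) (fderiv ℝ φ x w) := by
  have hs := fderiv_fderiv_symm h.isOpen h.contDiffOn hx
  simp only [koszul_apply, h.fderiv_eq hx (hG'.differentiableAt hx) (hG.differentiableAt hφx)]
  rw [hs v u, hs w u, hs w v, hG.symm _ hφx (fderiv ℝ φ x u),
    hG.symm _ hφx (fderiv ℝ φ x v)]
  ring

theorem fderiv_injective (h : IsPullbackOn G' G φ Ω') (hG' : IsMetricOn G' Ω') (hx : x ∈ Ω') :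
    Function.Injective (fderiv ℝ φ x) := by
  refine (injective_iff_map_eq_zero _).2 fun v hv ↦ hG'.nondegenerate x hx v fun w ↦ ?_
  simp [h.eq x hx, hv]

variable [FiniteDimensional ℝ E]

/-- The classical transformation law of Christoffel symbols. Testing against the image of `dφ`
suffices, since an injective endomorphism in finite dimension is onto. -/
theorem christoffel_eq (h : IsPullbackOn G' G φ Ω') (hG' : IsMetricOn G' Ω')
    (hG : IsMetricOn G Ω) (hx : x ∈ Ω') (hφx : φ x ∈ Ω) (u v : E) :
    fderiv ℝ φ x (christoffel G' x u v) = fderiv ℝ (fderiv ℝ φ) x u v +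
      christoffel G (φ x) (fderiv ℝ φ x u) (fderiv ℝ φ x v) := by
  refine hG.eq_of_forall hφx fun z ↦ ?_
  obtain ⟨w, rfl⟩ : ∃ w, fderiv ℝ φ x w = z :=
    LinearMap.surjective_of_injective (f := (fderiv ℝ φ x).toLinearMap)
      (h.fderiv_injective hG' hx) z
  rw [← h.eq x hx, hG'.christoffel_spec hx, h.koszul_eq hG' hG hx hφx]
  simp only [map_add, add_apply, hG.christoffel_spec hφx]
  ring

/-- The curvature tensor is natural under pullbacks. -/
theorem riemann_eq (h : IsPullbackOn G' G φ Ω') (hG' : IsMetricOn G' Ω') (hG : IsMetricOn G Ω)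
    (hm : Set.MapsTo φ Ω' Ω) (hx : x ∈ Ω') (u v w : E) :
    fderiv ℝ φ x (riemann G' x u v w) =
      riemann G (φ x) (fderiv ℝ φ x u) (fderiv ℝ φ x v) (fderiv ℝ φ x w) := by
  have hφ := (differentiableAt_of_contDiffOn h.isOpen h.contDiffOn hx).hasFDerivAt
  have hDφ := contDiffOn_fderiv h.isOpen h.contDiffOn
  have hD := (differentiableAt_of_contDiffOn h.isOpen hDφ hx).hasFDerivAt
  have hDD := (differentiableAt_of_contDiffOn h.isOpen
    (contDiffOn_fderiv h.isOpen hDφ) hx).hasFDerivAt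
  have hs := fderiv_fderiv_symm h.isOpen h.contDiffOn hx
  have hs3 := fderiv_fderiv_symm h.isOpen hDφ hx
  have hΓ' := (hG'.differentiableAt_christoffel hx).hasFDerivAt
  have hΓ := ((hG.differentiableAt_christoffel (hm hx)).hasFDerivAt.comp x hφ)
  -- The derivative of the transformation law. After antisymmetrizing in `u` and `v`, the third
  -- derivatives of `φ` cancel, and the second derivatives cancel against those from the quadratic
  -- terms in `Γ`.
  have key (a b c : E) : fderiv ℝ (fderiv ℝ φ) x a (christoffel G' x b c) +
      fderiv ℝ φ x (fderiv ℝ (christoffel G') x a b c) =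
      fderiv ℝ (fderiv ℝ (fderiv ℝ φ)) x a b c +
      (fderiv ℝ (christoffel G) (φ x) (fderiv ℝ φ x a) (fderiv ℝ φ x b) (fderiv ℝ φ x c) +
      christoffel G (φ x) (fderiv ℝ (fderiv ℝ φ) x a b) (fderiv ℝ φ x c) +
      christoffel G (φ x) (fderiv ℝ φ x b) (fderiv ℝ (fderiv ℝ φ) x a c)) := by
    have e : (fun y ↦ fderiv ℝ φ y (christoffel G' y b c)) =ᶠ[𝓝 x] fun y ↦
        fderiv ℝ (fderiv ℝ φ) y b c +
          christoffel G (φ y) (fderiv ℝ φ y b) (fderiv ℝ φ y c) := by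
      filter_upwards [h.isOpen.mem_nhds hx] with y hy
        using h.christoffel_eq hG' hG hy (hm hy) b c
    have h1 : HasFDerivAt (fun y ↦ fderiv ℝ φ y (christoffel G' y b c)) _ x :=
      hD.clm_apply ((hΓ'.clm_apply (hasFDerivAt_const b x)).clm_apply (hasFDerivAt_const c x))
    have h2 : HasFDerivAt (fun y ↦ fderiv ℝ (fderiv ℝ φ) y b c +
          christoffel G (φ y) (fderiv ℝ φ y b) (fderiv ℝ φ y c)) _ x :=
      ((hDD.clm_apply (hasFDerivAt_const b x)).clm_apply (hasFDerivAt_const c x)).add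
        ((hΓ.clm_apply (hD.clm_apply (hasFDerivAt_const b x))).clm_apply
          (hD.clm_apply (hasFDerivAt_const c x)))
    have := congrArg (fun f : E →L[ℝ] E ↦ f a) e.fderiv_eq
    simp only [h1.fderiv, h2.fderiv] at this
    simp at this
    rw [add_comm, this]
    abel
  have k1 := eq_sub_of_add_eq' (key u v w)
  have k2 := eq_sub_of_add_eq' (key v u w)
  simp only [riemann, map_add, map_sub, k1, k2, h.christoffel_eq hG' hG hx (hm hx)]
  rw [hs3 u v, hs v u]
  abel

end IsPullbackOn

end CoordMetric

/-! ### Coordinate expressions of a metric on a manifold -/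

section Charts

open CoordMetric

variable {E : Type*} [NormedAddCommGroup E] [NormedSpace ℝ E]
  {H : Type*} [TopologicalSpace H] (I : ModelWithCorners ℝ E H)
  {M : Type*} [TopologicalSpace M] [ChartedSpace H M]

/-- The change of coordinates from the preferred chart at `p` to the one at `q`. -/
noncomputable def transitionMap (p q : M) : E → E := extChartAt I q ∘ (extChartAt I p).symm

/-- The domain of `transitionMap I p q`. -/
def transitionDomain (p q : M) : Set E :=
  (extChartAt I p).target ∩ (extChartAt I p).symm ⁻¹' (extChartAt I q).source

theorem transitionMap_mapsTo (p q : M) :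
    Set.MapsTo (transitionMap I p q) (transitionDomain I p q) (extChartAt I q).target :=
  fun _ hx ↦ (extChartAt I q).map_source hx.2

theorem symm_transitionMap {p q : M} {x : E} (hx : x ∈ transitionDomain I p q) :
    (extChartAt I q).symm (transitionMap I p q x) = (extChartAt I p).symm x :=
  (extChartAt I q).left_inv hx.2

theorem mem_transitionDomain_symm {p : M} {x : E} (hx : x ∈ (extChartAt I p).target) :
    x ∈ transitionDomain I p ((extChartAt I p).symm x) :=
  ⟨hx, mem_extChartAt_source _⟩

theorem contDiffOn_transitionMap [IsManifold I ∞ M] (p q : M) :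
    ContDiffOn ℝ ∞ (transitionMap I p q) (transitionDomain I p q) :=
  contDiffOn_ext_coord_change q p

variable [I.Boundaryless]

theorem isOpen_transitionDomain (p q : M) : IsOpen (transitionDomain I p q) :=
  (continuousOn_extChartAt_symm p).isOpen_inter_preimage (isOpen_extChartAt_target p)
    (isOpen_extChartAt_source q)

theorem fderiv_transitionMap_self {p : M} {x : E} (hx : x ∈ (extChartAt I p).target) :
    fderiv ℝ (transitionMap I p p) x = .id ℝ E := by
  have : transitionMap I p p =ᶠ[𝓝 x] id := by
    filter_upwards [(isOpen_extChartAt_target p).mem_nhds hx] with y hy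
      using (extChartAt I p).right_inv hy
  rw [this.fderiv_eq, fderiv_id]

variable [IsManifold I ∞ M]

theorem differentiableAt_transitionMap {p q : M} {x : E} (hx : x ∈ transitionDomain I p q) :
    DifferentiableAt ℝ (transitionMap I p q) x :=
  differentiableAt_of_contDiffOn (isOpen_transitionDomain I p q) (contDiffOn_transitionMap I p q) hx

theorem fderiv_transitionMap_comp {p q r : M} {x : E} (hx : x ∈ transitionDomain I p q)
    (hr : transitionMap I p q x ∈ transitionDomain I q r) (v : E) :
    fderiv ℝ (transitionMap I q r) (transitionMap I p q x) (fderiv ℝ (transitionMap I p q) x v) =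
      fderiv ℝ (transitionMap I p r) x v := by
  have : transitionMap I p r =ᶠ[𝓝 x] transitionMap I q r ∘ transitionMap I p q := by
    filter_upwards [(isOpen_transitionDomain I p q).mem_nhds hx] with y hy
    simp only [transitionMap, Function.comp_apply, (extChartAt I q).left_inv hy.2]
  rw [this.fderiv_eq, fderiv_comp x (differentiableAt_transitionMap I hr)
    (differentiableAt_transitionMap I hx)]
  rfl

theorem fderiv_transitionMap_surjective {p q : M} {x : E} (hx : x ∈ transitionDomain I p q)
    (w : E) : ∃ v, fderiv ℝ (transitionMap I p q) x v = w := by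
  have hy : transitionMap I p q x ∈ transitionDomain I q p := by
    refine ⟨transitionMap_mapsTo I p q hx, ?_⟩
    rw [Set.mem_preimage, symm_transitionMap I hx]
    exact (extChartAt I p).map_target hx.1
  have hxx : transitionMap I q p (transitionMap I p q x) = x := by
    rw [transitionMap, Function.comp_apply, symm_transitionMap I hx]
    exact (extChartAt I p).right_inv hx.1
  refine ⟨fderiv ℝ (transitionMap I q p) (transitionMap I p q x) w, ?_⟩
  have := fderiv_transitionMap_comp I hy (by rwa [hxx]) w
  rw [hxx, fderiv_transitionMap_self I (transitionMap_mapsTo I p q hx)] at this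
  exact this

theorem fderiv_transitionMap_injective {p q : M} {x : E} (hx : x ∈ transitionDomain I p q)
    {v : E} (hv : fderiv ℝ (transitionMap I p q) x v = 0) : v = 0 := by
  have hy : transitionMap I p q x ∈ transitionDomain I q p := by
    refine ⟨transitionMap_mapsTo I p q hx, ?_⟩
    rw [Set.mem_preimage, symm_transitionMap I hx]
    exact (extChartAt I p).map_target hx.1
  have := fderiv_transitionMap_comp I hx hy v
  rw [hv, map_zero, fderiv_transitionMap_self I hx.1] at this
  exact this.symm

theorem tangentCoordChange_eq_fderiv (p q r : M) :
    tangentCoordChange I p q r = fderiv ℝ (transitionMap I p q) (extChartAt I p r) := by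
  rw [tangentCoordChange_def, I.range_eq_univ, fderivWithin_univ]
  rfl

/-! ### The metric in coordinates -/

variable (g : ∀ p : M, TangentSpace I p →L[ℝ] TangentSpace I p →L[ℝ] ℝ)

/-- The tangent space at each point is read in that point's own preferred chart, so the differential
of the inverse chart at `p` is a transition map into a chart that varies with `x`. -/
theorem localMetric_apply {p : M} {x : E} (hx : x ∈ (extChartAt I p).target) (v w : E) :
    localMetric I g p x v w = (g ((extChartAt I p).symm x) : E →L[ℝ] E →L[ℝ] ℝ)
      (fderiv ℝ (transitionMap I p ((extChartAt I p).symm x)) x v)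
      (fderiv ℝ (transitionMap I p ((extChartAt I p).symm x)) x w) := by
  have h1 : MDifferentiableAt 𝓘(ℝ, E) I (extChartAt I p).symm x := by
    have := mdifferentiableWithinAt_extChartAt_symm hx
    rwa [I.range_eq_univ, mdifferentiableWithinAt_univ] at this
  have h2 : (mfderiv 𝓘(ℝ, E) I (extChartAt I p).symm x : E →L[ℝ] E) =
      fderiv ℝ (transitionMap I p ((extChartAt I p).symm x)) x := by
    rw [h1.mfderiv, modelWithCornersSelf_coe, Set.range_id, fderivWithin_univ]
    rfl
  rw [← h2]
  rfl

theorem localMetric_extChartAt (p : M) (v w : E) :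
    localMetric I g p (extChartAt I p p) v w = (g p : E →L[ℝ] E →L[ℝ] ℝ) v w := by
  rw [localMetric_apply I g (mem_extChartAt_target p), extChartAt_to_inv,
    fderiv_transitionMap_self I (mem_extChartAt_target p)]
  rfl

theorem isPullbackOn_localMetric (p q : M) :
    IsPullbackOn (localMetric I g p) (localMetric I g q) (transitionMap I p q)
      (transitionDomain I p q) where
  isOpen := isOpen_transitionDomain I p q
  contDiffOn := contDiffOn_transitionMap I p q
  eq x hx v w := by
    have hx' := transitionMap_mapsTo I p q hx
    have hr := mem_transitionDomain_symm I hx'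
    rw [localMetric_apply I g hx.1, localMetric_apply I g hx', fderiv_transitionMap_comp I hx hr,
      fderiv_transitionMap_comp I hx hr, symm_transitionMap I hx]

/-- Smoothness of a section is tested in bundle trivializations; this identifies them with
coordinate expressions. -/
theorem trivializationAt_bilin_apply {p q : M} (hq : q ∈ (extChartAt I p).source) :
    (trivializationAt (E →L[ℝ] E →L[ℝ] ℝ)
      (fun q : M ↦ TangentSpace I q →L[ℝ] TangentSpace I q →L[ℝ] ℝ) p ⟨q, g q⟩).2 =
      localMetric I g p (extChartAt I p q) := by
  ext v w
  rw [localMetric_apply I g ((extChartAt I p).map_source hq), (extChartAt I p).left_inv hq,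
    ← tangentCoordChange_eq_fderiv]
  rw [extChartAt_source] at hq
  rw [hom_trivializationAt_apply]
  simp only [ContinuousLinearMap.inCoordinates, ContinuousLinearMap.comp_apply]
  rw [TangentBundle.symmL_trivializationAt_eq_core hq, Trivialization.continuousLinearMapAt_apply,
    Trivialization.linearMapAt_apply, if_pos (by simpa using hq), hom_trivializationAt_apply]
  simp only [ContinuousLinearMap.inCoordinates, ContinuousLinearMap.comp_apply]
  rw [TangentBundle.symmL_trivializationAt_eq_core hq]
  simp
  rfl

theorem contMDiff_section_iff_contDiffOn_localMetric :
    ContMDiff I (I.prod 𝓘(ℝ, E →L[ℝ] E →L[ℝ] ℝ)) ∞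
      (fun p ↦ TotalSpace.mk' (E →L[ℝ] E →L[ℝ] ℝ)
        (E := fun q : M ↦ TangentSpace I q →L[ℝ] TangentSpace I q →L[ℝ] ℝ) p (g p)) ↔
    ∀ p : M, ContDiffOn ℝ ∞ (localMetric I g p) (extChartAt I p).target := by
  have hbase (p : M) : (extChartAt I p).source = (trivializationAt (E →L[ℝ] E →L[ℝ] ℝ)
      (fun q : M ↦ TangentSpace I q →L[ℝ] TangentSpace I q →L[ℝ] ℝ) p).baseSet := by
    simp
  constructor
  · intro h p
    have h1 := ((trivializationAt (E →L[ℝ] E →L[ℝ] ℝ)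
      (fun q : M ↦ TangentSpace I q →L[ℝ] TangentSpace I q →L[ℝ] ℝ) p).contMDiffOn_section_iff
        (isOpen_extChartAt_source (I := I) p) (hbase p).subset).1 h.contMDiffOn
    have h2 := h1.comp (contMDiffOn_extChartAt_symm p)
      fun x hx ↦ (extChartAt I p).map_target hx
    refine (contMDiffOn_iff_contDiffOn.1 h2).congr fun x hx ↦ ?_
    rw [Function.comp_apply, trivializationAt_bilin_apply I g ((extChartAt I p).map_target hx),
      (extChartAt I p).right_inv hx]
  · intro h p
    rw [contMDiffAt_section]
    have hs := extChartAt_source_mem_nhds (I := I) p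
    have h1 : ContMDiffAt I 𝓘(ℝ, E →L[ℝ] E →L[ℝ] ℝ) ∞
        (localMetric I g p ∘ extChartAt I p) p :=
      ContMDiffAt.comp p (((h p).contDiffAt
        ((isOpen_extChartAt_target p).mem_nhds (mem_extChartAt_target p))).contMDiffAt)
        contMDiffAt_extChartAt
    refine h1.congr_of_eventuallyEq ?_
    filter_upwards [hs] with q hq using trivializationAt_bilin_apply I g hq

variable {I g}

theorem IsSemiRiemannianMetric.isMetricOn (hg : IsSemiRiemannianMetric I g) (p : M) :
    IsMetricOn (localMetric I g p) (extChartAt I p).target where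
  isOpen := isOpen_extChartAt_target p
  contDiffOn := (contMDiff_section_iff_contDiffOn_localMetric I g).1 hg.contMDiff p
  symm x hx v w := by
    rw [localMetric_apply I g hx, localMetric_apply I g hx]
    exact hg.symm _ _ _
  nondegenerate x hx v h := by
    have hr := mem_transitionDomain_symm I hx
    refine fderiv_transitionMap_injective I hr
      (hg.nondegenerate ((extChartAt I p).symm x) _ fun (w : E) ↦ ?_)
    obtain ⟨w, rfl⟩ := fderiv_transitionMap_surjective I hr w
    rw [← h w, localMetric_apply I g hx]

/-- `IsFlat` speaks only of chart centres. Any other point `x` of the chart is the centre of another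
preferred chart, and naturality carries the vanishing back along an injective differential. -/
theorem IsSemiRiemannianMetric.riemann_localMetric_eq_zero [FiniteDimensional ℝ E]
    (hg : IsSemiRiemannianMetric I g) (h : IsFlat I g)
    {p : M} {x : E} (hx : x ∈ (extChartAt I p).target) (u v w : E) :
    riemann (localMetric I g p) x u v w = 0 := by
  set q := (extChartAt I p).symm x with hq
  have hr : x ∈ transitionDomain I p q := mem_transitionDomain_symm I hx
  have hp : IsMetricOn (localMetric I g p) (transitionDomain I p q) :=
    { isOpen := isOpen_transitionDomain I p q
      contDiffOn := (hg.isMetricOn p).contDiffOn.mono Set.inter_subset_left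
      symm := fun y hy ↦ (hg.isMetricOn p).symm y hy.1
      nondegenerate := fun y hy ↦ (hg.isMetricOn p).nondegenerate y hy.1 }
  refine fderiv_transitionMap_injective I hr ?_
  rw [(isPullbackOn_localMetric I g p q).riemann_eq hp (hg.isMetricOn q)
    (transitionMap_mapsTo I p q) hr]
  exact h q _ _ _

end Charts

/-! ### The complete lift in induced charts of the tangent bundle -/

section TangentBundleCharts

open CoordMetric

variable {E : Type*} [NormedAddCommGroup E] [NormedSpace ℝ E]
  {H : Type*} [TopologicalSpace H] (I : ModelWithCorners ℝ E H)
  {M : Type*} [TopologicalSpace M] [ChartedSpace H M] [IsManifold I ∞ M]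

theorem TangentBundle.extChartAt_apply (U W : TangentBundle I M) :
    extChartAt I.tangent U W =
      (extChartAt I U.proj W.proj, tangentCoordChange I W.proj U.proj W.proj W.snd) := rfl

theorem TangentBundle.extChartAt_self (U : TangentBundle I M) :
    extChartAt I.tangent U U = (extChartAt I U.proj U.proj, U.snd) :=
  Prod.ext rfl (tangentCoordChange_self (E := E) (v := U.snd) (mem_extChartAt_source _))

theorem TangentBundle.proj_extChartAt_symm (U : TangentBundle I M) (z : E × E) :
    ((extChartAt I.tangent U).symm z).proj = (extChartAt I U.proj).symm z.1 := rfl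

theorem TangentBundle.snd_extChartAt_symm (U : TangentBundle I M) (z : E × E) :
    (((extChartAt I.tangent U).symm z).snd : E) =
      tangentCoordChange I U.proj ((extChartAt I U.proj).symm z.1)
        ((extChartAt I U.proj).symm z.1) z.2 := rfl

theorem TangentBundle.extChartAt_target (U : TangentBundle I M) :
    (extChartAt I.tangent U).target = (extChartAt I U.proj).target ×ˢ Set.univ := by
  rw [FiberBundle.extChartAt_target]
  congr 1
  refine Set.inter_eq_left.2 fun x hx ↦ ?_
  simpa using (extChartAt I U.proj).map_target hx

variable [I.Boundaryless]

/-- The fibre coordinate passes through the preferred chart at the moving base point; the chain rule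
removes this detour. -/
theorem transitionMap_tangent (U V : TangentBundle I M) {z : E × E}
    (hz : z.1 ∈ transitionDomain I U.proj V.proj) :
    transitionMap I.tangent U V z = tangentLift (transitionMap I U.proj V.proj) z := by
  have hr := mem_transitionDomain_symm I hz.1
  have h : transitionMap I U.proj ((extChartAt I U.proj).symm z.1) z.1 ∈
      transitionDomain I ((extChartAt I U.proj).symm z.1) V.proj := by
    refine ⟨transitionMap_mapsTo I _ _ hr, ?_⟩
    rw [Set.mem_preimage, symm_transitionMap I hr]
    exact hz.2
  have h1 : extChartAt I U.proj ((extChartAt I U.proj).symm z.1) = z.1 :=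
    (extChartAt I U.proj).right_inv hz.1
  have key := fderiv_transitionMap_comp I hr h z.2
  rw [transitionMap, Function.comp_apply, TangentBundle.extChartAt_apply,
    TangentBundle.snd_extChartAt_symm, TangentBundle.proj_extChartAt_symm,
    tangentCoordChange_eq_fderiv, tangentCoordChange_eq_fderiv, h1]
  exact Prod.ext rfl key

variable [FiniteDimensional ℝ E] {I}
  {g : ∀ p : M, TangentSpace I p →L[ℝ] TangentSpace I p →L[ℝ] ℝ}

/-- Metric compatibility expands `∂_y g` into two Christoffel terms, and the symmetry of `Γ` puts
`y` in the slot used by `verticalPart`. -/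
theorem completeLift_eq_liftBilin (hg : IsSemiRiemannianMetric I g) (U : TangentBundle I M)
    (ξ η : E × E) :
    (completeLift I g U : E × E →L[ℝ] E × E →L[ℝ] ℝ) ξ η =
      liftBilin (localMetric I g U.proj) (extChartAt I.tangent U U) ξ η := by
  have hm := hg.isMetricOn U.proj
  have hU := mem_extChartAt_target (I := I) U.proj
  have key (B : E →L[ℝ] E →L[ℝ] ℝ) (Γ : E →L[ℝ] E →L[ℝ] E) (y : E) :
      B ξ.1 (η.2 + Γ η.1 y) + B (ξ.2 + Γ ξ.1 y) η.1 =
        B (Γ ξ.1 y) η.1 + B ξ.1 (Γ η.1 y) + B ξ.1 η.2 + B ξ.2 η.1 := by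
    simp only [map_add, add_apply]
    ring
  have main (y : E) : liftBilin (localMetric I g U.proj) (extChartAt I U.proj U.proj, y) ξ η = _ :=
    liftBilin_apply _ _ _ _
  simp only [hm.compatible hU, hm.christoffel_symm hU _ ξ.1, hm.christoffel_symm hU _ η.1,
    localMetric_extChartAt] at main
  rw [TangentBundle.extChartAt_self]
  exact (key (g U.proj) (christoffel (localMetric I g U.proj) (extChartAt I U.proj U.proj))
    U.snd).trans (main U.snd).symm

/-- In the charts of `TM` induced by those of `M`, the complete lift of `g` is the complete lift
of the coordinate expression of `g`. -/
theorem localMetric_completeLift (hg : IsSemiRiemannianMetric I g) (U : TangentBundle I M)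
    {z : E × E} (hz : z.1 ∈ (extChartAt I U.proj).target) :
    localMetric I.tangent (completeLift I g) U z = liftBilin (localMetric I g U.proj) z := by
  refine ContinuousLinearMap.ext fun ξ ↦ ContinuousLinearMap.ext fun η ↦ ?_
  have hzU : z ∈ (extChartAt I.tangent U).target := by
    rw [TangentBundle.extChartAt_target]; exact ⟨hz, Set.mem_univ _⟩
  -- The pointwise formula is available in the preferred chart at `V`; naturality under the tangent
  -- map of the transition moves it to the chart at `U`.
  set V := (extChartAt I.tangent U).symm z with hV
  have hd : z.1 ∈ transitionDomain I U.proj V.proj := mem_transitionDomain_symm I hz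
  have hτ : transitionMap I.tangent U V =ᶠ[𝓝 z] tangentLift (transitionMap I U.proj V.proj) := by
    filter_upwards [((isOpen_transitionDomain I U.proj V.proj).preimage
      continuous_fst).mem_nhds hd] with y hy using transitionMap_tangent I U V hy
  have hVV : extChartAt I.tangent V V = tangentLift (transitionMap I U.proj V.proj) z :=
    hτ.eq_of_nhds
  rw [localMetric_apply I.tangent _ hzU, ← hV, completeLift_eq_liftBilin hg, hVV, hτ.fderiv_eq]
  exact ((isPullbackOn_localMetric I g U.proj V.proj).liftBilin_eq hd
    ((hg.isMetricOn _).differentiableAt hz)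
    ((hg.isMetricOn _).differentiableAt (transitionMap_mapsTo I _ _ hd)) ξ η).symm

theorem isSemiRiemannianMetric_completeLift (hg : IsSemiRiemannianMetric I g) :
    IsSemiRiemannianMetric I.tangent (completeLift I g) where
  symm U ξ η := by
    have h := (hg.isMetricOn U.proj).liftBilin.symm (extChartAt I.tangent U U)
      ⟨mem_extChartAt_target U.proj, Set.mem_univ _⟩ ξ η
    exact (completeLift_eq_liftBilin hg U ξ η).trans
      (h.trans (completeLift_eq_liftBilin hg U η ξ).symm)
  nondegenerate U ξ h := by
    refine (hg.isMetricOn U.proj).liftBilin.nondegenerate (extChartAt I.tangent U U)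
      ⟨mem_extChartAt_target U.proj, Set.mem_univ _⟩ ξ fun η ↦ ?_
    exact (completeLift_eq_liftBilin hg U ξ η).symm.trans (h η)
  contMDiff := by
    refine (contMDiff_section_iff_contDiffOn_localMetric I.tangent (completeLift I g)).2 fun U ↦ ?_
    rw [TangentBundle.extChartAt_target]
    exact (hg.isMetricOn U.proj).liftBilin.contDiffOn.congr
      fun z hz ↦ localMetric_completeLift hg U hz.1

end TangentBundleCharts

/-! ### Curvature of the complete lift on the manifold -/

section Curvature

variable {E : Type*} [NormedAddCommGroup E] [NormedSpace ℝ E]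

namespace CoordMetric

/-- Curvature depends only on the germ of the metric. The conclusion here is again about germs
because `riemann` differentiates `christoffel` once more. -/
theorem christoffel_congr {G G' : E → E →L[ℝ] E →L[ℝ] ℝ} {x : E} (h : G =ᶠ[𝓝 x] G') :
    christoffel G =ᶠ[𝓝 x] christoffel G' := by
  filter_upwards [h, h.fderiv (𝕜 := ℝ)] with y hy hy'
  simp only [christoffel, koszul, hy, hy']

theorem riemann_congr {G G' : E → E →L[ℝ] E →L[ℝ] ℝ} {x : E} (h : G =ᶠ[𝓝 x] G') (u v w : E) :
    riemann G x u v w = riemann G' x u v w := by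
  have h' := christoffel_congr h
  simp only [riemann, h'.fderiv_eq, h'.eq_of_nhds]

theorem ricci_congr {G G' : E → E →L[ℝ] E →L[ℝ] ℝ} {x : E} (h : G =ᶠ[𝓝 x] G') :
    ricci G x = ricci G' x := by
  ext v w
  rw [ricci_apply, ricci_apply]
  congr 1
  exact LinearMap.ext fun u ↦ riemann_congr h u v w

theorem scalar_congr [FiniteDimensional ℝ E] {G G' : E → E →L[ℝ] E →L[ℝ] ℝ} {x : E}
    (h : G =ᶠ[𝓝 x] G') : scalar G x = scalar G' x := by
  simp only [scalar, ricci_congr h, h.eq_of_nhds]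

end CoordMetric

open CoordMetric

variable [FiniteDimensional ℝ E]
  {H : Type*} [TopologicalSpace H] {I : ModelWithCorners ℝ E H} [I.Boundaryless]
  {M : Type*} [TopologicalSpace M] [ChartedSpace H M] [IsManifold I ∞ M]
  {g : ∀ p : M, TangentSpace I p →L[ℝ] TangentSpace I p →L[ℝ] ℝ}

theorem localMetric_completeLift_eventuallyEq (hg : IsSemiRiemannianMetric I g)
    (U : TangentBundle I M) :
    localMetric I.tangent (completeLift I g) U =ᶠ[𝓝 (extChartAt I.tangent U U)]
      liftBilin (localMetric I g U.proj) := by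
  filter_upwards [(isOpen_extChartAt_target (I := I.tangent) U).mem_nhds
    (mem_extChartAt_target U)] with z hz
  rw [TangentBundle.extChartAt_target] at hz
  exact localMetric_completeLift hg U hz.1

theorem riemannTensor_completeLift (hg : IsSemiRiemannianMetric I g) (U : TangentBundle I M)
    (ζ ξ η : E × E) :
    (riemannTensor I.tangent (completeLift I g) U ζ ξ η : E × E) =
      (riemann (localMetric I g U.proj) (extChartAt I U.proj U.proj) ζ.1 ξ.1 η.1,
        fderiv ℝ (fun x ↦ riemann (localMetric I g U.proj) x ζ.1 ξ.1 η.1)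
            (extChartAt I U.proj U.proj) U.snd +
          riemann (localMetric I g U.proj) (extChartAt I U.proj U.proj) ζ.2 ξ.1 η.1 +
          riemann (localMetric I g U.proj) (extChartAt I U.proj U.proj) ζ.1 ξ.2 η.1 +
          riemann (localMetric I g U.proj) (extChartAt I U.proj U.proj) ζ.1 ξ.1 η.2) := by
  refine (riemann_congr (localMetric_completeLift_eventuallyEq hg U) ζ ξ η).trans ?_
  rw [(hg.isMetricOn U.proj).riemann_liftBilin (mem_extChartAt_target U.proj),
    TangentBundle.extChartAt_self]

theorem ricciTensor_completeLift (hg : IsSemiRiemannianMetric I g) (U : TangentBundle I M)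
    (ξ η : E × E) :
    ricciTensor I.tangent (completeLift I g) U ξ η = 2 * ricciTensor I g U.proj ξ.1 η.1 := by
  have h := ricci_congr (localMetric_completeLift_eventuallyEq hg U)
  refine (congrArg (fun f : E × E →ₗ[ℝ] E × E →ₗ[ℝ] ℝ ↦ f ξ η) h).trans ?_
  exact (hg.isMetricOn U.proj).ricci_liftBilin (mem_extChartAt_target U.proj) ξ η

theorem scalarCurvature_completeLift (hg : IsSemiRiemannianMetric I g) (U : TangentBundle I M) :
    scalarCurvature I.tangent (completeLift I g) U = 0 :=
  (scalar_congr (localMetric_completeLift_eventuallyEq hg U)).trans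
    ((hg.isMetricOn U.proj).scalar_liftBilin (mem_extChartAt_target U.proj))

theorem isFlat_completeLift_iff (hg : IsSemiRiemannianMetric I g) :
    IsFlat I.tangent (completeLift I g) ↔ IsFlat I g := by
  constructor
  · intro h p u v w
    -- The zero vector serves as a point over `p`; the base component of `R̂` does not depend on the
    -- fibre coordinate.
    have h1 := h ⟨p, 0⟩ ((u, 0) : E × E) ((v, 0) : E × E) ((w, 0) : E × E)
    exact congrArg Prod.fst
      ((riemannTensor_completeLift hg ⟨p, 0⟩ (u, 0) (v, 0) (w, 0)).symm.trans h1)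
  · intro h U
    -- The `dR` term needs `R` to vanish on a neighbourhood in a fixed chart, not just at its
    -- centre.
    have h1 (u v w y : E) : fderiv ℝ (fun x ↦ riemann (localMetric I g U.proj) x u v w)
        (extChartAt I U.proj U.proj) y = 0 := by
      have : (fun x ↦ riemann (localMetric I g U.proj) x u v w)
          =ᶠ[𝓝 (extChartAt I U.proj U.proj)] fun _ ↦ (0 : E) := by
        filter_upwards [(isOpen_extChartAt_target (I := I) U.proj).mem_nhds
          (mem_extChartAt_target U.proj)] with x hx
          using hg.riemann_localMetric_eq_zero h hx u v w
      rw [this.fderiv_eq]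
      simp
    have h2 (u v w : E) :
        riemann (localMetric I g U.proj) (extChartAt I U.proj U.proj) u v w = 0 := h U.proj u v w
    have key (ζ ξ η : E × E) :
        riemannTensor I.tangent (completeLift I g) U ζ ξ η = (0 : E × E) := by
      refine (riemannTensor_completeLift hg U ζ ξ η).trans ?_
      simp only [h2, add_zero]
      exact Prod.ext rfl (h1 _ _ _ U.snd)
    exact key

theorem isRicciFlat_completeLift_iff (hg : IsSemiRiemannianMetric I g) :
    IsRicciFlat I.tangent (completeLift I g) ↔ IsRicciFlat I g := by
  constructor
  · intro h p v w
    have h1 := h ⟨p, 0⟩ ((v, 0) : E × E) ((w, 0) : E × E)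
    have h2 := (ricciTensor_completeLift hg ⟨p, 0⟩ (v, 0) (w, 0)).symm.trans h1
    simpa using h2
  · intro h U ξ η
    refine (ricciTensor_completeLift hg U ξ η).trans ?_
    exact mul_eq_zero_of_right 2 (h U.proj _ _)

end Curvature

theorem mainTheorem6
    {E : Type*} [NormedAddCommGroup E] [NormedSpace ℝ E] [FiniteDimensional ℝ E]
    {H : Type*} [TopologicalSpace H] (I : ModelWithCorners ℝ E H) [I.Boundaryless]
    {M : Type*} [TopologicalSpace M] [ChartedSpace H M] [IsManifold I ∞ M]
    (g : ∀ p : M, TangentSpace I p →L[ℝ] TangentSpace I p →L[ℝ] ℝ)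
    (hg : IsSemiRiemannianMetric I g) :
    IsSemiRiemannianMetric I.tangent (completeLift I g) ∧
    (IsFlat I.tangent (completeLift I g) ↔ IsFlat I g) ∧
    (IsRicciFlat I.tangent (completeLift I g) ↔ IsRicciFlat I g) ∧
    IsScalarFlat I.tangent (completeLift I g) :=
  ⟨isSemiRiemannianMetric_completeLift hg, isFlat_completeLift_iff hg,
    isRicciFlat_completeLift_iff hg, scalarCurvature_completeLift hg⟩
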